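/- Let $m,n\ge 0$, $d=m+n$ and $D=\mathbb{R}_{\ge 0}^m\times\mathbb{R}^n$. Let $(X_t,\mathbb{P}^x)_{t\ge 0,\,x\in D}$ be a time-homogeneous Markov process with state space $D$ on a filtered measurable space, with $X_0=x$ $\mathbb{P}^x$-almost surely. The process may be killed: it takes values in the one-point compactification $D\cup\{\partial\}$ ($\partial$ isolated if $D$ is compact), $\partial$ is absorbing, and functions on $D$ are extended by $0$ to $\partial$. Assume that (i) $X$ is stochastically continuous: for all $s\ge 0$ and $x\in D$, $X_t\to X_s$ in $\mathbb{P}^x$-probability in $D\cup\{\partial\}$ as $t\to s$; (ii) $X$ is affine: there are functions $\Phi:\mathbb{R}_{\ge 0}\times i\mathbb{R}^d\to\mathbb{C}$ and $\psi:\mathbb{R}_{\ge 0}\times i\mathbb{R}^d\to\mathbb{C}^d$ such that $$\mathbb{E}^x\left[e^{\langle X_t,u\rangle}\right]=\Phi(t,u)\,e^{\langle x,\psi(t,u)\rangle}\qquad\text{for all } x\in D,\ t\ge 0,\ u\in i\mathbb{R}^d,$$ where $\langle x,u\rangle=\sum_{k=1}^d x_k u_k$. Then $X$ is a Feller process. That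 is, let $P_tf(x)=\mathbb{E}^x[f(X_t)]$ and let $C_0(D)$ be the space of continuous functions $D\to\mathbb{C}$ that vanish at infinity. Then $P_t(C_0(D))\subseteq C_0(D)$ for every $t\ge 0$, $P_0f=f$ and $P_{s+t}f=P_sP_tf$ for all $s,t\ge0$ and $f\in C_0(D)$, and $P_tf(x)\to f(x)$ as $t\downarrow 0$ for all $f\in C_0(D)$ and $x\in D$. -/

import Mathlib

open MeasureTheory Filter Topology
open scoped NNReal ENNReal OnePoint ZeroAtInfty ProbabilityTheory

noncomputable section

namespace AffineProcess

/-- `OnePoint E` is the state space `E` with the cemetery `∞` adjoined, as the point at infinity of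
the one-point compactification (an isolated point when `E` is compact). It carries the Borel
σ-algebra. -/
instance instMeasurableSpaceOnePoint (E : Type*) [TopologicalSpace E] :
    MeasurableSpace (OnePoint E) := borel (OnePoint E)

instance instBorelSpaceOnePoint (E : Type*) [TopologicalSpace E] : BorelSpace (OnePoint E) := ⟨rfl⟩

/-- The law of `X t` when the process is started at `y`: for a point of `E` it is the law of `X t`
under the corresponding measure of the family `P`; a process that is in the cemetery stays there. -/
def stateLaw {E Ω : Type*} [TopologicalSpace E] [MeasurableSpace Ω]
    (P : E → Measure Ω) (X : ℝ≥0 → Ω → OnePoint E) (t : ℝ≥0) (y : OnePoint E) :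
    Measure (OnePoint E) :=
  y.elim (Measure.dirac ∞) fun x => (P x).map (X t)

/-- A time-homogeneous Markov process `(X t, P x)`, `t ≥ 0`, `x ∈ E`, with state space `E`, on the
filtered space `(Ω, 𝓕)`. It may be killed: `X t ω = ∞` means that it has been killed by time `t`.
Conservative processes are those that never take the value `∞`. -/
structure MarkovProcess (E Ω : Type*) [TopologicalSpace E] [MeasurableSpace E] [BorelSpace E]
    [mΩ : MeasurableSpace Ω] where
  /-- the filtration -/
  𝓕 : Filtration ℝ≥0 mΩ
  /-- the process -/
  X : ℝ≥0 → Ω → OnePoint E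
  /-- `P x` is the law of the process started at `x` -/
  P : E → Measure Ω
  isProbabilityMeasure : ∀ x, IsProbabilityMeasure (P x)
  adapted : ∀ t, Measurable[𝓕 t] (X t)
  measurable_law : ∀ (t : ℝ≥0) (B : Set (OnePoint E)), MeasurableSet B →
    Measurable fun x : E => P x (X t ⁻¹' B)
  initial : ∀ x : E, ∀ᵐ ω ∂(P x), X 0 ω = (x : OnePoint E)
  markov : ∀ (x : E) (s t : ℝ≥0) (B : Set (OnePoint E)), MeasurableSet B →
    (P x)⟦X (s + t) ⁻¹' B | 𝓕 s⟧ =ᵐ[P x] fun ω => (stateLaw P X t (X s ω)).real B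

namespace MarkovProcess

variable {E Ω : Type*} [TopologicalSpace E] [MeasurableSpace E] [BorelSpace E] [MeasurableSpace Ω]

/-- The transition semigroup `P_t f (x) = 𝔼ˣ[f (X_t)]`, with the convention `f ∞ = 0`. -/
def semigroup (M : MarkovProcess E Ω) (t : ℝ≥0) (f : E → ℂ) (x : E) : ℂ :=
  ∫ ω, (M.X t ω).elim 0 f ∂(M.P x)

/-- `X_t → X_s` in probability under every `P x`, as `t → s`. The neighbourhoods of the diagonal
form the unique uniformity of the compact Hausdorff space `OnePoint E`. -/
def IsStochasticallyContinuous (M : MarkovProcess E Ω) : Prop :=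
  ∀ (x : E) (s : ℝ≥0), ∀ V ∈ 𝓝ˢ (Set.diagonal (OnePoint E)),
    Tendsto (fun t : ℝ≥0 => M.P x {ω | (M.X t ω, M.X s ω) ∉ V}) (𝓝 s) (𝓝 0)

/-- The Feller property: the operators `P_t` map `C₀(E)` into itself, form a semigroup on it, and
`P_t f → f` pointwise as `t → 0`, for `f ∈ C₀(E)`. -/
structure IsFeller (M : MarkovProcess E Ω) : Prop where
  map_zeroAtInfty : ∀ (t : ℝ≥0) (f : C₀(E, ℂ)), ∃ g : C₀(E, ℂ), ∀ x, g x = M.semigroup t f x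
  semigroup_zero : ∀ (f : C₀(E, ℂ)) (x : E), M.semigroup 0 f x = f x
  semigroup_add : ∀ (s t : ℝ≥0) (f : C₀(E, ℂ)) (x : E),
    M.semigroup (s + t) f x = M.semigroup s (M.semigroup t f) x
  tendsto_zero : ∀ (f : C₀(E, ℂ)) (x : E),
    Tendsto (fun t : ℝ≥0 => M.semigroup t f x) (𝓝 0) (𝓝 (f x))

end MarkovProcess

/-- The canonical state space `D = ℝ_{≥ 0}^m × ℝ^n`. -/
abbrev StateSpace (m n : ℕ) : Type := (Fin m → ℝ≥0) × (Fin n → ℝ)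

/-- `ℂ^d`, `d = m + n`, with vectors written as `u = (u_I, u_J)`. -/
abbrev ComplexSpace (m n : ℕ) : Type := (Fin m → ℂ) × (Fin n → ℂ)

/-- The bilinear pairing `⟨x, u⟩ = ∑ i, x_i u_i`. -/
def pairing {m n : ℕ} (x : StateSpace m n) (u : ComplexSpace m n) : ℂ :=
  ∑ i, ((x.1 i : ℝ) : ℂ) * u.1 i + ∑ j, (x.2 j : ℂ) * u.2 j

/-- The set `iℝ^d` of purely imaginary vectors. -/
def imaginarySpace (m n : ℕ) : Set (ComplexSpace m n) :=
  {u | (∀ i, (u.1 i).re = 0) ∧ ∀ j, (u.2 j).re = 0}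

/-- An affine process: `𝔼ˣ[exp ⟨X_t, u⟩] = Φ(t, u) exp ⟨x, ψ(t, u)⟩` for all `x ∈ D`, `t ≥ 0`
and `u ∈ iℝ^d`. The values of `Φ` and `ψ` at other `u` are irrelevant. -/
def IsAffine {m n : ℕ} {Ω : Type*} [MeasurableSpace Ω]
    (M : MarkovProcess (StateSpace m n) Ω) : Prop :=
  ∃ (Φ : ℝ≥0 → ComplexSpace m n → ℂ) (ψ : ℝ≥0 → ComplexSpace m n → ComplexSpace m n),
    ∀ (x : StateSpace m n) (t : ℝ≥0), ∀ u ∈ imaginarySpace m n,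
      M.semigroup t (fun y => Complex.exp (pairing y u)) x =
        Φ t u * Complex.exp (pairing x (ψ t u))

end AffineProcess

end

/-! Write `law t x` for the law of `X t` on `D` under `P x`, a measure of mass at most one because
of killing. Since the transform is `Φ(t,u) exp ⟨x, ψ(t,u)⟩`, comparing characteristic functions
gives `law t x ∗ law t y = law t (x + y) ∗ law t 0` (`IsAffine.law_conv`). This identity, together
with continuity of the characteristic functions in `x`, carries the whole proof; no regularity of
`Φ` or `ψ` is needed.

Continuity of `P_t f` follows from Lévy's continuity theorem (`IsAffine.continuous_integral`). By
the semigroup property, invariance of `C₀(D)` is only needed for small `t`, where stochastic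
continuity keeps the laws started at `0` and at finitely many unit vectors concentrated near their
starting points. It remains to see that the mass of a bounded set vanishes as `x → ∞`
(`IsAffine.eventually_law_real_lt`).

If a nonnegative coordinate of `x` is large, its Laplace transform at `1` is multiplicative up to
the factor at `0`, hence decays geometrically (`IsAffine.law_coord_le`). If the real part is large,
the laws started at integer points have centers that are additive up to a bounded error, so these
centers escape to infinity (`exists_center_of_conv`). Convolving with such a law moves the starting
point back into a compact set, where the laws are tight, and this forces the law at `x` away from
bounded sets (`IsAffine.law_real_ball_lt`). -/

namespace AffineProcess

namespace MarkovProcess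

/-! ### Transition laws and the semigroup of a Markov process -/

section General

variable {E Ω : Type*} [TopologicalSpace E] [MeasurableSpace E] [BorelSpace E] [MeasurableSpace Ω]

theorem measurableEmbedding_coe : MeasurableEmbedding (OnePoint.some : E → OnePoint E) :=
  OnePoint.isOpenEmbedding_coe.measurableEmbedding

theorem measurable_elim {β : Type*} [MeasurableSpace β] {f : E → β} (hf : Measurable f) (c : β) :
    Measurable fun y : OnePoint E => y.elim c f := by
  have h := measurableEmbedding_coe.measurable_extend hf (measurable_const (a := c))
  convert h using 1
  funext y
  induction y using OnePoint.rec with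
  | infty =>
    rw [Function.extend_apply']
    · rfl
    · rintro ⟨x, hx⟩
      exact OnePoint.coe_ne_infty x hx
  | coe x => exact (OnePoint.coe_injective.extend_apply f (fun _ => c) x).symm

variable (M : MarkovProcess E Ω)

instance (x : E) : IsProbabilityMeasure (M.P x) := M.isProbabilityMeasure x

theorem measurable_X (t : ℝ≥0) : Measurable (M.X t) := (M.adapted t).mono (M.𝓕.le t) le_rfl

/-- The law of `X t` under `P x`, restricted to the state space. -/
noncomputable def law (t : ℝ≥0) (x : E) : Measure E :=
  ((M.P x).map (M.X t)).comap OnePoint.some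

theorem law_apply (t : ℝ≥0) (x : E) (s : Set E) (hs : MeasurableSet s) :
    M.law t x s = M.P x (M.X t ⁻¹' (OnePoint.some '' s)) := by
  rw [law, measurableEmbedding_coe.comap_apply,
    Measure.map_apply (M.measurable_X t) (measurableEmbedding_coe.measurableSet_image.2 hs)]

theorem law_univ_le (t : ℝ≥0) (x : E) : M.law t x Set.univ ≤ 1 := by
  rw [law_apply _ _ _ _ MeasurableSet.univ]
  exact prob_le_one

instance (t : ℝ≥0) (x : E) : IsFiniteMeasure (M.law t x) :=
  ⟨(M.law_univ_le t x).trans_lt ENNReal.one_lt_top⟩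

theorem law_real_le_one (t : ℝ≥0) (x : E) (s : Set E) : (M.law t x).real s ≤ 1 := by
  refine ENNReal.toReal_le_of_le_ofReal zero_le_one ?_
  rw [ENNReal.ofReal_one]
  exact (measure_mono (Set.subset_univ _)).trans (M.law_univ_le t x)

theorem semigroup_eq_integral_map (t : ℝ≥0) {f : E → ℂ} (hf : Measurable f) (x : E) :
    M.semigroup t f x = ∫ y, y.elim 0 f ∂((M.P x).map (M.X t)) := by
  rw [integral_map (M.measurable_X t).aemeasurable
    (measurable_elim hf 0).aestronglyMeasurable]
  rfl

theorem semigroup_eq_integral_law (t : ℝ≥0) {f : E → ℂ} (hf : Measurable f) (x : E) :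
    M.semigroup t f x = ∫ y, f y ∂(M.law t x) := by
  have h1 : ∫ y, f y ∂(M.law t x)
      = ∫ z, z.elim 0 f ∂((M.law t x).map OnePoint.some) := by
    rw [measurableEmbedding_coe.integral_map]
    rfl
  rw [h1, law, measurableEmbedding_coe.map_comap, M.semigroup_eq_integral_map t hf x,
    setIntegral_eq_integral_of_forall_compl_eq_zero]
  intro y hy
  induction y using OnePoint.rec with
  | infty => rfl
  | coe y => exact absurd ⟨y, rfl⟩ hy

theorem measurable_map_X (t : ℝ≥0) : Measurable fun x : E => (M.P x).map (M.X t) := by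
  refine Measure.measurable_of_measurable_coe _ fun B hB => ?_
  simp_rw [Measure.map_apply (M.measurable_X t) hB]
  exact M.measurable_law t B hB

theorem measurable_stateLaw (t : ℝ≥0) : Measurable (stateLaw M.P M.X t) :=
  measurable_elim (M.measurable_map_X t) _

instance (t : ℝ≥0) (y : OnePoint E) : IsProbabilityMeasure (stateLaw M.P M.X t y) := by
  induction y using OnePoint.rec with
  | infty => exact Measure.dirac.isProbabilityMeasure
  | coe y => exact Measure.isProbabilityMeasure_map (M.measurable_X t).aemeasurable

/-- The Chapman–Kolmogorov equation for the laws on `OnePoint E`. -/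
theorem map_X_add (s t : ℝ≥0) (x : E) :
    (M.P x).map (M.X (s + t)) = ((M.P x).map (M.X s)).bind (stateLaw M.P M.X t) := by
  ext B hB
  rw [Measure.bind_apply hB (M.measurable_stateLaw t).aemeasurable,
    Measure.map_apply (M.measurable_X _) hB,
    lintegral_map (f := fun y => stateLaw M.P M.X t y B)
      ((Measure.measurable_coe hB).comp (M.measurable_stateLaw t)) (M.measurable_X s)]
  have hpre : MeasurableSet (M.X (s + t) ⁻¹' B) := M.measurable_X _ hB
  have h1 : (M.P x).real (M.X (s + t) ⁻¹' B)
      = ∫ ω, (stateLaw M.P M.X t (M.X s ω)).real B ∂(M.P x) := by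
    rw [← integral_congr_ae (M.markov x s t B hB), integral_condExp (M.𝓕.le s),
      integral_indicator_const _ hpre, smul_eq_mul, mul_one]
  have hmeas : Measurable fun ω => stateLaw M.P M.X t (M.X s ω) B :=
    (Measure.measurable_coe hB).comp ((M.measurable_stateLaw t).comp (M.measurable_X s))
  have h2 : ∫ ω, (stateLaw M.P M.X t (M.X s ω)).real B ∂(M.P x)
      = (∫⁻ ω, stateLaw M.P M.X t (M.X s ω) B ∂(M.P x)).toReal :=
    integral_toReal hmeas.aemeasurable (ae_of_all _ fun ω => measure_lt_top _ _)
  rw [h2, measureReal_def, ENNReal.toReal_eq_toReal_iff' (measure_ne_top _ _)] at h1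
  · exact h1
  · refine ((lintegral_mono fun ω => prob_le_one).trans_lt ?_).ne
    simp

theorem measurable_semigroup (t : ℝ≥0) {f : E → ℂ} (hf : Measurable f) :
    Measurable (M.semigroup t f) := by
  have : M.semigroup t f = fun x => ∫ y, y.elim 0 f ∂((⟨_, M.measurable_map_X t⟩ :
      ProbabilityTheory.Kernel E (OnePoint E)) x) := by
    funext x
    exact M.semigroup_eq_integral_map t hf x
  rw [this]
  have : ProbabilityTheory.IsMarkovKernel (⟨_, M.measurable_map_X t⟩ :
      ProbabilityTheory.Kernel E (OnePoint E)) :=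
    ⟨fun x => Measure.isProbabilityMeasure_map (M.measurable_X t).aemeasurable⟩
  exact ((measurable_elim hf 0).stronglyMeasurable.integral_kernel).measurable

theorem semigroup_add (s t : ℝ≥0) {f : E → ℂ} (hf : Measurable f) {C : ℝ} (hC : ∀ y, ‖f y‖ ≤ C)
    (x : E) : M.semigroup (s + t) f x = M.semigroup s (M.semigroup t f) x := by
  rw [M.semigroup_eq_integral_map _ hf, M.semigroup_eq_integral_map _ (M.measurable_semigroup t hf)]
  have hint : Integrable (fun y : OnePoint E => (y.elim 0 f : ℂ))
      ((M.P x).map (M.X (s + t))) := by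
    have := Measure.isProbabilityMeasure_map (μ := M.P x) (M.measurable_X (s + t)).aemeasurable
    refine Integrable.of_bound (measurable_elim hf 0).aestronglyMeasurable (max C 0)
      (ae_of_all _ fun y => ?_)
    induction y using OnePoint.rec with
    | infty => simp
    | coe y => exact (hC y).trans (le_max_left _ _)
  -- The law of `X s` is viewed as a kernel from `Unit`, so that Chapman–Kolmogorov becomes a
  -- composition of kernels and integrates against `f`.
  let κ : ProbabilityTheory.Kernel (OnePoint E) (OnePoint E) := ⟨_, M.measurable_stateLaw t⟩
  let η : ProbabilityTheory.Kernel Unit (OnePoint E) :=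
    ProbabilityTheory.Kernel.const Unit ((M.P x).map (M.X s))
  have hcomp : (κ ∘ₖ η) () = (M.P x).map (M.X (s + t)) := by
    rw [ProbabilityTheory.Kernel.comp_apply, M.map_X_add]
    rfl
  rw [← hcomp] at hint ⊢
  rw [ProbabilityTheory.Kernel.integral_comp hint]
  refine integral_congr_ae (ae_of_all _ fun y => ?_)
  induction y using OnePoint.rec with
  | infty =>
    change ∫ y : OnePoint E, y.elim 0 f ∂(Measure.dirac OnePoint.infty) = 0
    rw [integral_dirac' _ _ (measurable_elim hf 0).stronglyMeasurable]
    rfl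
  | coe y => exact (M.semigroup_eq_integral_map t hf y).symm

theorem semigroup_zero (f : E → ℂ) (x : E) : M.semigroup 0 f x = f x := by
  have : M.semigroup 0 f x = ∫ _, f x ∂(M.P x) := by
    refine integral_congr_ae ?_
    filter_upwards [M.initial x] with ω hω
    rw [hω]
    rfl
  rw [this]
  simp

end General

/-! ### Stochastic continuity and reduction to small times -/

section Small

variable {E Ω : Type*} [TopologicalSpace E] [T1Space E]
  [MeasurableSpace E] [BorelSpace E] [MeasurableSpace Ω] (M : MarkovProcess E Ω)

variable {M} in
theorem IsStochasticallyContinuous.tendsto_compl (h : M.IsStochasticallyContinuous) (x : E)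
    {U : Set (OnePoint E)} (hU : U ∈ 𝓝 (x : OnePoint E)) :
    Tendsto (fun t : ℝ≥0 => M.P x (M.X t ⁻¹' Uᶜ)) (𝓝 0) (𝓝 0) := by
  obtain ⟨U', hU'U, hU'o, hxU'⟩ := mem_nhds_iff.1 hU
  -- Since `X 0 = x` almost surely, leaving `U'` at time `t` means that `(X t, X 0)` lies in `U'ᶜ ×
  -- {x}`, a closed set disjoint from the diagonal.
  have hV : (U'ᶜ ×ˢ {(x : OnePoint E)})ᶜ ∈ 𝓝ˢ (Set.diagonal (OnePoint E)) := by
    refine (hU'o.isClosed_compl.prod isClosed_singleton).isOpen_compl.mem_nhdsSet.2 ?_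
    rintro ⟨y, z⟩ (rfl : y = z) ⟨hy1, hy2⟩
    have hyx : y = x := hy2
    exact hy1 (hyx ▸ hxU')
  refine tendsto_of_tendsto_of_tendsto_of_le_of_le tendsto_const_nhds (h x 0 _ hV)
    (fun _ => zero_le) fun t => ?_
  refine measure_mono_ae ?_
  filter_upwards [M.initial x] with ω hω hmem
  change ¬ _ ∈ (_)ᶜ
  rw [Set.notMem_compl_iff]
  exact ⟨fun hh => hmem (hU'U hh), hω⟩

variable {M} in
/-- Right continuity at time zero, for bounded functions that are continuous at the starting
point. -/
theorem IsStochasticallyContinuous.tendsto_semigroup (h : M.IsStochasticallyContinuous) (x : E)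
    {f : E → ℂ} (hf : Measurable f) {C : ℝ} (hC : ∀ y, ‖f y‖ ≤ C) (hfx : ContinuousAt f x) :
    Tendsto (fun t : ℝ≥0 => M.semigroup t f x) (𝓝 0) (𝓝 (f x)) := by
  have hC0 : 0 ≤ C := (norm_nonneg _).trans (hC x)
  rw [Metric.tendsto_nhds]
  intro ε hε
  let g : OnePoint E → ℂ := fun y => y.elim 0 f
  have hg : ContinuousAt g x := OnePoint.continuousAt_coe.2 hfx
  have hgm : Measurable g := measurable_elim hf 0
  have hgC : ∀ y, ‖g y‖ ≤ C := by
    intro y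
    induction y using OnePoint.rec with
    | infty => simpa [g] using hC0
    | coe y => exact hC y
  have hU : {y | dist (g y) (g x) < ε / 2} ∈ 𝓝 (x : OnePoint E) :=
    hg (Metric.ball_mem_nhds _ (half_pos hε))
  obtain ⟨U, hUs, hUo, hxU⟩ := mem_nhds_iff.1 hU
  have hlim := h.tendsto_compl x (hUo.mem_nhds hxU)
  have hlim' : Tendsto (fun t : ℝ≥0 => 2 * C * (M.P x).real (M.X t ⁻¹' Uᶜ)) (𝓝 0) (𝓝 0) := by
    have := ((ENNReal.tendsto_toReal ENNReal.zero_ne_top).comp hlim).const_mul (2 * C)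
    simpa [Measure.real] using this
  filter_upwards [hlim'.eventually (gt_mem_nhds (half_pos hε))] with t ht
  have hpre : MeasurableSet (M.X t ⁻¹' Uᶜ) := M.measurable_X t hUo.measurableSet.compl
  have hint : Integrable (fun ω => g (M.X t ω)) (M.P x) :=
    Integrable.of_bound (hgm.comp (M.measurable_X t)).aestronglyMeasurable C
      (ae_of_all _ fun _ => hgC _)
  have e1 : M.semigroup t f x - f x = ∫ ω, (g (M.X t ω) - g x) ∂(M.P x) := by
    rw [integral_sub hint (integrable_const _)]
    simp only [integral_const, probReal_univ, one_smul]
    rfl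
  rw [dist_eq_norm, e1]
  calc ‖∫ ω, (g (M.X t ω) - g x) ∂(M.P x)‖
      ≤ ∫ ω, (ε / 2 + (M.X t ⁻¹' Uᶜ).indicator (fun _ => 2 * C) ω) ∂(M.P x) := by
        refine norm_integral_le_of_norm_le ?_ (ae_of_all _ fun ω => ?_)
        · exact (integrable_const _).add ((integrable_const _).indicator hpre)
        · by_cases hω : M.X t ω ∈ U
          · rw [Set.indicator_of_notMem (by simpa using hω), add_zero, ← dist_eq_norm]
            exact (hUs hω).le
          · rw [Set.indicator_of_mem (by simpa using hω)]
            refine (norm_sub_le _ _).trans ?_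
            linarith [hgC (M.X t ω), hgC x]
    _ = ε / 2 + 2 * C * (M.P x).real (M.X t ⁻¹' Uᶜ) := by
        rw [integral_add (integrable_const _) ((integrable_const _).indicator hpre),
          integral_indicator_const _ hpre]
        simp [mul_comm]
    _ < ε := by linarith

variable {M} in
theorem IsStochasticallyContinuous.eventually_lt_law (h : M.IsStochasticallyContinuous) (x : E)
    {U : Set E} (hU : U ∈ 𝓝 x) (hUm : MeasurableSet U) {c : ℝ} (hc : c < 1) :
    ∀ᶠ t in 𝓝 (0 : ℝ≥0), c < (M.law t x).real U := by
  have hf : Measurable (U.indicator fun _ => (1 : ℂ)) := measurable_const.indicator hUm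
  have hx : x ∈ U := mem_of_mem_nhds hU
  have := h.tendsto_semigroup x hf (C := 1)
    (fun y => by by_cases hy : y ∈ U <;> simp [hy])
    ((continuousAt_const (y := (1 : ℂ))).congr (by
      filter_upwards [hU] with y hy
      simp [hy]))
  have h2 := Complex.continuous_re.continuousAt.tendsto.comp this
  simp only [Set.indicator_of_mem hx, Complex.one_re] at h2
  filter_upwards [h2.eventually (lt_mem_nhds hc)] with t ht
  simpa [M.semigroup_eq_integral_law t hf x, integral_indicator_const _ hUm] using ht

/-- The Feller property follows from the invariance of `C₀` for small times. -/
theorem isFeller_of_eventually (h : M.IsStochasticallyContinuous)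
    (hs : ∀ᶠ t in 𝓝 (0 : ℝ≥0), ∀ f : C₀(E, ℂ), ∃ g : C₀(E, ℂ), ∀ x, g x = M.semigroup t f x) :
    M.IsFeller := by
  have hb : ∀ f : C₀(E, ℂ), ∀ y, ‖f y‖ ≤ ‖f.toBCF‖ := fun f y => f.toBCF.norm_coe_le_norm y
  refine ⟨fun t f => ?_, fun f x => M.semigroup_zero f x,
    fun s t f x => M.semigroup_add s t f.continuous.measurable (hb f) x,
    fun f x => h.tendsto_semigroup x f.continuous.measurable (hb f) f.continuous.continuousAt⟩
  -- A given `t` is cut into `N + 1` equal steps, each short enough for `hs`; iterating the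
  -- short-time operator keeps `C₀` invariant.
  have hlim : Tendsto (fun N : ℕ => t / ((N : ℝ≥0) + 1)) atTop (𝓝 0) := by
    have h1 : Tendsto (fun N : ℕ => (N : ℝ≥0) + 1) atTop atTop :=
      tendsto_atTop_mono (fun N => le_self_add) (tendsto_natCast_atTop_atTop (R := ℝ≥0))
    simpa [div_eq_mul_inv] using (tendsto_inv_atTop_zero.comp h1).const_mul t
  obtain ⟨N, hN⟩ := (hlim.eventually hs).exists
  have key : ∀ (k : ℕ) (f : C₀(E, ℂ)), ∃ g : C₀(E, ℂ), ∀ x,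
      g x = M.semigroup (k * (t / ((N : ℝ≥0) + 1))) f x := by
    intro k
    induction k with
    | zero => exact fun f => ⟨f, fun x => by simp [M.semigroup_zero]⟩
    | succ k ih =>
      intro f
      obtain ⟨g₁, hg₁⟩ := hN f
      obtain ⟨g₂, hg₂⟩ := ih g₁
      refine ⟨g₂, fun x => ?_⟩
      rw [hg₂, Nat.cast_succ, add_mul, one_mul,
        M.semigroup_add _ _ (f := f) f.continuous.measurable (hb f)]
      congr 1
      funext y
      exact hg₁ y
  obtain ⟨g, hg⟩ := key (N + 1) f
  refine ⟨g, fun x => ?_⟩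
  rw [hg, Nat.cast_succ, mul_div_cancel₀ _ (by positivity)]

end Small

end MarkovProcess

/-! ### Characteristic functions on the canonical state space -/

section Canonical

variable {m n : ℕ}

/-- The inclusion of the canonical state space in Euclidean space. -/
def toEuclidean (m n : ℕ) : StateSpace m n →+ EuclideanSpace ℝ (Fin m ⊕ Fin n) where
  toFun x := WithLp.toLp 2 (Sum.elim (fun i => (x.1 i : ℝ)) x.2)
  map_zero' := by
    ext k
    cases k <;> simp
  map_add' x y := by
    ext k
    cases k <;> simp

/-- The retraction of Euclidean space onto the canonical state space. -/
noncomputable def ofEuclidean (m n : ℕ) (ξ : EuclideanSpace ℝ (Fin m ⊕ Fin n)) : StateSpace m n :=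
  (fun i => (ξ (Sum.inl i)).toNNReal, fun j => ξ (Sum.inr j))

theorem ofEuclidean_toEuclidean (x : StateSpace m n) :
    ofEuclidean m n (toEuclidean m n x) = x := by
  ext <;> simp [ofEuclidean, toEuclidean]

theorem continuous_toEuclidean : Continuous (toEuclidean m n) := by
  refine (PiLp.continuous_toLp 2 _).comp (continuous_pi fun k => ?_)
  cases k with
  | inl i => simp only [Sum.elim_inl]; fun_prop
  | inr j => simp only [Sum.elim_inr]; fun_prop

theorem continuous_ofEuclidean : Continuous (ofEuclidean m n) := by
  unfold ofEuclidean
  refine Continuous.prodMk (continuous_pi fun i => ?_) (continuous_pi fun j => ?_)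
  · exact continuous_real_toNNReal.comp (by fun_prop)
  · fun_prop

/-- The imaginary vector with imaginary part `ξ`. -/
def imaginaryVector (ξ : EuclideanSpace ℝ (Fin m ⊕ Fin n)) : ComplexSpace m n :=
  (fun i => (ξ (Sum.inl i) : ℂ) * Complex.I, fun j => (ξ (Sum.inr j) : ℂ) * Complex.I)

theorem imaginaryVector_mem (ξ : EuclideanSpace ℝ (Fin m ⊕ Fin n)) :
    imaginaryVector ξ ∈ imaginarySpace m n :=
  ⟨fun i => by simp [imaginaryVector], fun j => by simp [imaginaryVector]⟩

theorem pairing_imaginaryVector (x : StateSpace m n) (ξ : EuclideanSpace ℝ (Fin m ⊕ Fin n)) :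
    pairing x (imaginaryVector ξ) = (inner ℝ (toEuclidean m n x) ξ : ℝ) * Complex.I := by
  simp only [pairing, imaginaryVector, toEuclidean, AddMonoidHom.coe_mk, ZeroHom.coe_mk,
    PiLp.inner_apply, Fintype.sum_sum_type, Sum.elim_inl, Sum.elim_inr]
  simp only [RCLike.inner_apply, conj_trivial]
  push_cast
  rw [add_mul, Finset.sum_mul, Finset.sum_mul]
  congr 1 <;> exact Finset.sum_congr rfl fun _ _ => by ring

theorem pairing_add (x y : StateSpace m n) (u : ComplexSpace m n) :
    pairing (x + y) u = pairing x u + pairing y u := by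
  simp only [pairing, Prod.fst_add, Prod.snd_add, Pi.add_apply, NNReal.coe_add,
    Complex.ofReal_add, add_mul, Finset.sum_add_distrib]
  ring

theorem pairing_zero_left (u : ComplexSpace m n) : pairing (0 : StateSpace m n) u = 0 := by
  simp [pairing]

theorem continuous_pairing_left (u : ComplexSpace m n) :
    Continuous fun x : StateSpace m n => pairing x u := by
  unfold pairing
  fun_prop

/-! ### The convolution identity and weak continuity in the starting point -/

section Law

variable {Ω : Type*} [MeasurableSpace Ω] (M : MarkovProcess (StateSpace m n) Ω)

theorem charFun_map_law (t : ℝ≥0) (x : StateSpace m n)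
    (ξ : EuclideanSpace ℝ (Fin m ⊕ Fin n)) :
    charFun ((M.law t x).map (toEuclidean m n)) ξ
      = M.semigroup t (fun y => Complex.exp (pairing y (imaginaryVector ξ))) x := by
  rw [M.semigroup_eq_integral_law t
    (f := fun y => Complex.exp (pairing y (imaginaryVector ξ)))
    (Complex.continuous_exp.comp (continuous_pairing_left _)).measurable, charFun_apply,
    integral_map continuous_toEuclidean.measurable.aemeasurable (by fun_prop)]
  simp_rw [pairing_imaginaryVector]

variable {M}

/-- The convolution identity for the laws of an affine process. -/
theorem IsAffine.law_conv (haff : IsAffine M) (t : ℝ≥0) (x y : StateSpace m n) :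
    M.law t x ∗ M.law t y = M.law t (x + y) ∗ M.law t 0 := by
  obtain ⟨Φ, ψ, h⟩ := haff
  -- The retraction undoes the inclusion, so measures on `D` may be compared in Euclidean space,
  -- where characteristic functions determine them.
  have hinj : Function.Injective (Measure.map (ofEuclidean m n) ∘ Measure.map (toEuclidean m n)) := by
    intro μ ν hμν
    simpa [Function.comp_def, Measure.map_map continuous_ofEuclidean.measurable
      continuous_toEuclidean.measurable, ofEuclidean_toEuclidean] using hμν
  refine hinj ?_
  simp only [Function.comp_apply]
  congr 1
  rw [Measure.map_conv_addMonoidHom _ continuous_toEuclidean.measurable,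
    Measure.map_conv_addMonoidHom _ continuous_toEuclidean.measurable]
  refine Measure.ext_of_charFun ?_
  funext ξ
  simp only [charFun_conv, charFun_map_law, h _ _ _ (imaginaryVector_mem ξ)]
  rw [pairing_add, pairing_zero_left, Complex.exp_add, Complex.exp_zero]
  ring

/-- For fixed `t` and `u`, the starting point enters only through the exponential of a linear form.
-/
theorem IsAffine.continuous_charFun (haff : IsAffine M) (t : ℝ≥0)
    (ξ : EuclideanSpace ℝ (Fin m ⊕ Fin n)) :
    Continuous fun x => charFun ((M.law t x).map (toEuclidean m n)) ξ := by
  obtain ⟨Φ, ψ, h⟩ := haff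
  simp only [charFun_map_law, h _ _ _ (imaginaryVector_mem ξ)]
  exact continuous_const.mul (Complex.continuous_exp.comp (continuous_pairing_left _))

theorem IsAffine.continuous_mass (haff : IsAffine M) (t : ℝ≥0) :
    Continuous fun x => (M.law t x).real Set.univ := by
  have h := Complex.continuous_re.comp (haff.continuous_charFun t 0)
  simpa [Function.comp_def, charFun_zero, map_measureReal_apply,
    continuous_toEuclidean.measurable] using h

/-- At `u = 0` the mass is `Φ(t,0)` times an exponential, which never vanishes; zero mass at one
point forces `Φ(t,0) = 0` and hence zero mass everywhere. This permits normalisation to probability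
measures. -/
theorem IsAffine.law_ne_zero (haff : IsAffine M) (t : ℝ≥0) (h0 : M.law t 0 ≠ 0)
    (x : StateSpace m n) : M.law t x ≠ 0 := by
  obtain ⟨Φ, ψ, h⟩ := haff
  have key : ∀ y, (((M.law t y).real Set.univ : ℝ) : ℂ) = Φ t (imaginaryVector 0)
      * Complex.exp (pairing y (ψ t (imaginaryVector 0))) := by
    intro y
    rw [← h _ _ _ (imaginaryVector_mem 0), ← charFun_map_law, charFun_zero,
      map_measureReal_apply continuous_toEuclidean.measurable MeasurableSet.univ,
      Set.preimage_univ]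
  intro hx
  have h1 := key x
  rw [hx] at h1
  have hΦ : Φ t (imaginaryVector 0) = 0 := by
    simpa [Complex.exp_ne_zero] using h1.symm
  have h2 := key 0
  rw [hΦ, zero_mul, Complex.ofReal_eq_zero] at h2
  exact h0 (Measure.measure_univ_eq_zero.1 ((measureReal_eq_zero_iff (measure_ne_top _ _)).1 h2))

/-- The laws of an affine process depend weakly continuously on the starting point. -/
theorem IsAffine.continuous_integral (haff : IsAffine M) (t : ℝ≥0) (h0 : M.law t 0 ≠ 0)
    {𝕜 : Type*} [RCLike 𝕜] (f : BoundedContinuousFunction (StateSpace m n) 𝕜) :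
    Continuous fun x => ∫ y, f y ∂(M.law t x) := by
  let μ : StateSpace m n → FiniteMeasure (EuclideanSpace ℝ (Fin m ⊕ Fin n)) :=
    fun x => ⟨(M.law t x).map (toEuclidean m n), inferInstance⟩
  have hμ : ∀ x, (μ x).toMeasure = (M.law t x).map (toEuclidean m n) := fun _ => rfl
  have hmass : ∀ x, ((μ x).mass : ℝ) = (M.law t x).real Set.univ := by
    intro x
    change ((μ x).toMeasure Set.univ).toReal = _
    rw [hμ, Measure.map_apply continuous_toEuclidean.measurable MeasurableSet.univ,
      Set.preimage_univ]
    rfl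
  have hne : ∀ x, μ x ≠ 0 := by
    intro x hx
    have h1 : ((μ x).mass : ℝ) = 0 := by simp [hx]
    rw [hmass] at h1
    exact haff.law_ne_zero t h0 x
      (Measure.measure_univ_eq_zero.1 ((measureReal_eq_zero_iff (measure_ne_top _ _)).1 h1))
  have hmassc : Continuous fun x => (μ x).mass := by
    refine continuous_induced_rng.2 ?_
    have h := haff.continuous_mass t
    simp only [← hmass] at h
    exact h
  have hμc : Continuous μ := by
    refine continuous_iff_seqContinuous.2 fun x a hx => ?_
    -- Lévy's theorem concerns probability measures, so the masses and the normalised measures are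
    -- treated separately.
    refine FiniteMeasure.tendsto_of_tendsto_normalize_testAgainstNN_of_tendsto_mass ?_
      ((hmassc.tendsto a).comp hx)
    refine ProbabilityMeasure.tendsto_iff_tendsto_charFun.2 fun ξ => ?_
    have hcf : ∀ y, charFun ((μ y).normalize : Measure _) ξ
        = (((μ y).mass : ℝ)⁻¹ : ℝ) • charFun ((M.law t y).map (toEuclidean m n)) ξ := by
      intro y
      rw [FiniteMeasure.toMeasure_normalize_eq_of_nonzero _ (hne y)]
      simp only [charFun_apply]
      rw [integral_smul_nnreal_measure]
      rfl
    simp only [Function.comp_apply, hcf]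
    have hc : Continuous fun y => (((μ y).mass : ℝ)⁻¹ : ℝ) •
        charFun ((M.law t y).map (toEuclidean m n)) ξ := by
      refine Continuous.smul (Continuous.inv₀ (NNReal.continuous_coe.comp hmassc) fun y => ?_)
        (haff.continuous_charFun t ξ)
      exact NNReal.coe_ne_zero.2 ((FiniteMeasure.mass_nonzero_iff _).2 (hne y))
    exact (hc.tendsto a).comp hx
  refine continuous_iff_continuousAt.2 fun a => ?_
  have h1 := (FiniteMeasure.tendsto_iff_forall_integral_rclike_tendsto 𝕜).1 (hμc.tendsto a)
    (f.compContinuous ⟨ofEuclidean m n, continuous_ofEuclidean⟩)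
  have h2 : ∀ x, ∫ ξ, f.compContinuous ⟨ofEuclidean m n, continuous_ofEuclidean⟩ ξ
      ∂(μ x).toMeasure = ∫ y, f y ∂(M.law t x) := by
    intro x
    rw [hμ, integral_map continuous_toEuclidean.measurable.aemeasurable
      (BoundedContinuousFunction.continuous _).aestronglyMeasurable]
    simp [ofEuclidean_toEuclidean]
  simp only [h2] at h1
  exact h1

end Law

end Canonical

/-! ### Concentration of measures under convolution -/

section Concentration

variable {V : Type*} [NormedAddCommGroup V] [MeasurableSpace V] [BorelSpace V]

/-- Disjoint balls cannot carry more than the total mass. This is how approximate centers of one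
measure are compared. -/
theorem dist_lt_of_one_lt_measureReal_ball_add {μ : Measure V} [IsFiniteMeasure μ]
    (hμ : μ Set.univ ≤ 1) {a b : V} {r s : ℝ}
    (h : 1 < μ.real (Metric.ball a r) + μ.real (Metric.ball b s)) : dist a b < r + s := by
  by_contra! hcon
  rw [← measureReal_union (Metric.ball_disjoint_ball hcon) Metric.isOpen_ball.measurableSet] at h
  have h1 : μ.real (Metric.ball a r ∪ Metric.ball b s) ≤ μ.real Set.univ :=
    measureReal_mono (Set.subset_univ _)
  have h2 : μ.real Set.univ ≤ 1 :=
    ENNReal.toReal_le_of_le_ofReal zero_le_one (by rwa [ENNReal.ofReal_one])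
  linarith

variable [SecondCountableTopology V]

theorem measureReal_ball_mul_le_conv (μ ν : Measure V) [IsFiniteMeasure μ] [IsFiniteMeasure ν]
    (a b : V) (r s : ℝ) :
    μ.real (Metric.ball a r) * ν.real (Metric.ball b s)
      ≤ (μ ∗ ν).real (Metric.ball (a + b) (r + s)) := by
  rw [← measureReal_prod_prod, Measure.conv,
    map_measureReal_apply measurable_add Metric.isOpen_ball.measurableSet]
  refine measureReal_mono ?_
  rintro ⟨x, y⟩ ⟨hx, hy⟩
  exact (dist_add_add_le x y a b).trans_lt (add_lt_add hx hy)

/-- The convolution's mass of a ball is the `ν`-average of the `μ`-masses of its translates, so some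
translate reaches the average. -/
theorem exists_lt_measureReal_ball_of_conv {μ ν : Measure V} [IsFiniteMeasure μ]
    [IsFiniteMeasure ν] (hν : ν Set.univ ≤ 1) {c r : ℝ} {z : V} (hc : 0 ≤ c)
    (h : c < (μ ∗ ν).real (Metric.ball z r)) : ∃ a, c < μ.real (Metric.ball a r) := by
  by_contra! hcon
  refine h.not_ge (ENNReal.toReal_le_of_le_ofReal hc ?_)
  rw [Measure.conv, Measure.map_apply measurable_add Metric.isOpen_ball.measurableSet,
    Measure.prod_apply_symm (measurable_add Metric.isOpen_ball.measurableSet)]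
  calc ∫⁻ y, μ ((fun x => (x, y)) ⁻¹' ((fun p : V × V => p.1 + p.2) ⁻¹' Metric.ball z r)) ∂ν
      ≤ ∫⁻ _, ENNReal.ofReal c ∂ν := by
        refine lintegral_mono fun y => ?_
        have e : (fun x => (x, y)) ⁻¹' ((fun p : V × V => p.1 + p.2) ⁻¹' Metric.ball z r)
            = Metric.ball (z - y) r := by
          ext x
          simp only [Set.mem_preimage, Metric.mem_ball, dist_eq_norm]
          rw [sub_sub_eq_add_sub]
        rw [e]
        exact ENNReal.le_ofReal_iff_toReal_le (measure_ne_top _ _) hc |>.2 (hcon _)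
    _ = ENNReal.ofReal c * ν Set.univ := lintegral_const _
    _ ≤ ENNReal.ofReal c := mul_le_of_le_one_right' hν

theorem conv_measureReal_norm_ge_le {μ ν : Measure V} [IsFiniteMeasure μ] [IsFiniteMeasure ν]
    (hμ : μ.real Set.univ ≤ 1) (hν : ν.real Set.univ ≤ 1) (r : ℝ) :
    (μ ∗ ν).real {ξ | 2 * r ≤ ‖ξ‖} ≤ μ.real {ξ | r ≤ ‖ξ‖} + ν.real {ξ | r ≤ ‖ξ‖} := by
  have hm : ∀ c : ℝ, MeasurableSet {ξ : V | c ≤ ‖ξ‖} := fun c =>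
    (isClosed_le continuous_const continuous_norm).measurableSet
  rw [Measure.conv, map_measureReal_apply measurable_add (hm _)]
  calc (μ.prod ν).real ((fun p : V × V => p.1 + p.2) ⁻¹' {ξ | 2 * r ≤ ‖ξ‖})
      ≤ (μ.prod ν).real ({ξ | r ≤ ‖ξ‖} ×ˢ Set.univ ∪ Set.univ ×ˢ {ξ | r ≤ ‖ξ‖}) := by
        refine measureReal_mono ?_
        rintro ⟨x, y⟩ (hxy : 2 * r ≤ ‖x + y‖)
        by_cases hx : r ≤ ‖x‖
        · exact Or.inl ⟨hx, trivial⟩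
        · refine Or.inr ⟨trivial, ?_⟩
          change r ≤ ‖y‖
          linarith [norm_add_le x y]
    _ ≤ _ := measureReal_union_le _ _
    _ ≤ _ := by
        rw [measureReal_prod_prod, measureReal_prod_prod]
        exact add_le_add (mul_le_of_le_one_right measureReal_nonneg hν)
          (mul_le_of_le_one_left measureReal_nonneg hμ)

/-- Induction on the `ℓ¹` norm: each unit step towards the origin costs at most `C`, and the extra
`1` pays for `S 0`. -/
theorem le_of_subadditive_int {n : ℕ} {S : (Fin n → ℤ) → ℝ} {C : ℝ}
    (hadd : ∀ k l, S (k + l) ≤ S k + S l) (h0 : S 0 ≤ C)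
    (hpos : ∀ j, S (Pi.single j 1) ≤ C) (hneg : ∀ j, S (Pi.single j (-1)) ≤ C)
    (k : Fin n → ℤ) : S k ≤ C * ((∑ j, (k j).natAbs : ℕ) + 1) := by
  generalize hN : ∑ j, (k j).natAbs = N
  induction N generalizing k with
  | zero =>
    have : k = 0 := by
      funext j
      simpa using (Finset.sum_eq_zero_iff.1 hN) j (Finset.mem_univ j)
    simpa [this] using h0
  | succ N ih =>
    obtain ⟨j, hj⟩ : ∃ j, k j ≠ 0 := by
      by_contra! hcon
      simp [hcon] at hN
    have step : ∀ s : ℤ, (k j - s).natAbs + 1 = (k j).natAbs → S (Pi.single j s) ≤ C →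
        S k ≤ C * ((N + 1 : ℕ) + 1) := by
      intro s hs hS
      have hsum : ∑ i, ((k - Pi.single j s : Fin n → ℤ) i).natAbs = N := by
        have : ∑ i, (((k - Pi.single j s : Fin n → ℤ) i).natAbs + if i = j then 1 else 0)
            = ∑ i, (k i).natAbs := by
          refine Finset.sum_congr rfl fun i _ => ?_
          by_cases hij : i = j
          · subst hij
            simpa using hs
          · simp [hij]
        rw [Finset.sum_add_distrib, Finset.sum_ite_eq' Finset.univ j] at this
        simp only [Finset.mem_univ, if_true] at this
        omega
      have h1 := hadd (k - Pi.single j s) (Pi.single j s)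
      rw [sub_add_cancel] at h1
      have h2 := ih _ hsum
      push_cast
      linarith
    rcases lt_or_gt_of_ne hj with h | h
    · exact step (-1) (by omega) (hneg j)
    · exact step 1 (by omega) (hpos j)

/-- A family of nearly concentrated sub-probability measures that is multiplicative up to the
factor `ν 0` moves off to infinity. -/
theorem exists_center_of_conv {n : ℕ} (ν : (Fin n → ℤ) → Measure (Fin n → ℝ))
    [∀ k, IsFiniteMeasure (ν k)] (hν : ∀ k, ν k Set.univ ≤ 1)
    (hconv : ∀ k l, ν k ∗ ν l = ν (k + l) ∗ ν 0) {δ : ℝ} (hδn : 20 * (n + 1) * δ = 1)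
    (h0 : 9 / 10 < (ν 0).real (Metric.ball 0 δ))
    (h1 : ∀ j, 9 / 10 < (ν (Pi.single j 1)).real (Metric.ball (Pi.single j 1) δ))
    (h2 : ∀ j, 9 / 10 < (ν (Pi.single j (-1))).real (Metric.ball (Pi.single j (-1)) δ))
    (k : Fin n → ℤ) :
    ∃ a : Fin n → ℝ, 1 / 2 < (ν k).real (Metric.ball a (2 * δ)) ∧
      ‖fun j => (k j : ℝ)‖ / 2 - 1 / 2 ≤ ‖a‖ := by
  have hex : ∀ k, ∃ a, 4 / 5 < (ν k).real (Metric.ball a (2 * δ)) := by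
    intro k
    -- `ν k ∗ ν (-k) = ν 0 ∗ ν 0` has mass above `(9/10)² > 4/5` on the ball of radius `2δ` about
    -- `0`.
    refine exists_lt_measureReal_ball_of_conv (ν := ν (-k)) (z := 0) (hν _) (by norm_num) ?_
    rw [hconv, add_neg_cancel]
    have h := measureReal_ball_mul_le_conv (ν 0) (ν 0) 0 0 δ δ
    rw [add_zero, ← two_mul] at h
    nlinarith
  choose a ha using hex
  have hone : ∀ k b, 9 / 10 < (ν k).real (Metric.ball b δ) → dist (a k) b < 3 * δ := by
    intro k b hb
    have := dist_lt_of_one_lt_measureReal_ball_add (hν k) (a := a k) (b := b) (r := 2 * δ) (s := δ)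
      (by linarith [ha k])
    linarith
  have hadd : ∀ k l, dist (a (k + l)) (a k + a l) < 7 * δ := by
    intro k l
    have e1 := measureReal_ball_mul_le_conv (ν k) (ν l) (a k) (a l) (2 * δ) (2 * δ)
    have e2 := measureReal_ball_mul_le_conv (ν (k + l)) (ν 0) (a (k + l)) 0 (2 * δ) δ
    rw [hconv] at e1
    rw [add_zero] at e2
    have hle : (ν (k + l) ∗ ν 0) Set.univ ≤ 1 := by
      rw [Measure.conv, Measure.map_apply measurable_add MeasurableSet.univ, Set.preimage_univ,
        ← Set.univ_prod_univ, Measure.prod_prod]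
      exact mul_le_one' (hν _) (hν _)
    -- The two masses exceed `(4/5)(9/10)` and `(4/5)²`, whose sum is above one; the radii add up to
    -- `7δ`.
    have := dist_lt_of_one_lt_measureReal_ball_add hle (a := a (k + l)) (b := a k + a l)
      (r := 2 * δ + δ) (s := 2 * δ + 2 * δ) (by nlinarith [ha k, ha l, ha (k + l)])
    linarith
  let c : (Fin n → ℤ) → (Fin n → ℝ) := fun k j => (k j : ℝ)
  -- Adding `7δ` absorbs the additivity defect and makes the deviation from `k` subadditive. At `0`
  -- and at the unit vectors it is at most `3δ + 7δ`. Hence `‖a k - k‖ ≤ 10δ(n‖k‖ + 1)`, which is at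
  -- most `‖k‖/2 + 1/2` by the choice of `δ`.
  have hS := le_of_subadditive_int (S := fun k => ‖a k - c k‖ + 7 * δ) (C := 10 * δ)
    (fun k l => ?_) ?_ (fun j => ?_) (fun j => ?_) k
  · refine ⟨a k, by linarith [ha k], ?_⟩
    have hsum : ((∑ j, (k j).natAbs : ℕ) : ℝ) ≤ n * ‖c k‖ := by
      push_cast
      calc ∑ j, ((k j).natAbs : ℝ) ≤ ∑ _j : Fin n, ‖c k‖ := by
            refine Finset.sum_le_sum fun j _ => ?_
            rw [Nat.cast_natAbs, Int.cast_abs, ← Real.norm_eq_abs]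
            exact norm_le_pi_norm (c k) j
        _ = n * ‖c k‖ := by simp
    have hδ : 0 < δ := by
      by_contra! hcon
      have : (0 : ℝ) ≤ n := Nat.cast_nonneg n
      nlinarith
    have h3 : ‖c k‖ ≤ ‖a k‖ + ‖a k - c k‖ := by
      have := norm_sub_norm_le (c k) (a k)
      rw [norm_sub_rev] at this
      linarith
    have h4 : 10 * δ * ((∑ j, (k j).natAbs : ℕ) + 1) ≤ 10 * δ * (n * ‖c k‖ + 1) := by gcongr
    have h5 : 0 ≤ ‖c k‖ := norm_nonneg _
    have h6 : 0 ≤ (n : ℝ) * δ := by positivity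
    change ‖c k‖ / 2 - 1 / 2 ≤ ‖a k‖
    have h7 : 10 * δ * (n * ‖c k‖ + 1) = 10 * (n * δ) * ‖c k‖ + 10 * δ := by ring
    have h8 : 10 * (n * δ) * ‖c k‖ ≤ 1 / 2 * ‖c k‖ :=
      mul_le_mul_of_nonneg_right (by linarith) h5
    have h9 : 10 * δ ≤ 1 / 2 := by linarith
    linarith
  · have h := hadd k l
    rw [dist_eq_norm] at h
    have e : a (k + l) - c (k + l) = (a (k + l) - (a k + a l)) + ((a k - c k) + (a l - c l)) := by
      have : c (k + l) = c k + c l := by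
        funext j
        simp [c]
      rw [this]
      abel
    rw [e]
    have n1 := norm_add_le (a (k + l) - (a k + a l)) ((a k - c k) + (a l - c l))
    have n2 := norm_add_le (a k - c k) (a l - c l)
    linarith
  · have h := hone 0 0 h0
    have e : c 0 = 0 := by
      funext j
      simp [c]
    simp only [e]
    rw [dist_eq_norm] at h
    linarith
  · have h := hone _ _ (h1 j)
    have e : c (Pi.single j 1) = Pi.single j 1 := by
      funext i
      by_cases hij : i = j
      · subst hij; simp [c]
      · simp [c, hij]
    simp only [e]
    rw [dist_eq_norm] at h
    linarith
  · have h := hone _ _ (h2 j)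
    have e : c (Pi.single j (-1)) = Pi.single j (-1) := by
      funext i
      by_cases hij : i = j
      · subst hij; simp [c]
      · simp [c, hij]
    simp only [e]
    rw [dist_eq_norm] at h
    linarith

end Concentration

/-! ### Escape of mass to infinity and the Feller property -/

section Feller

variable {m n : ℕ} {Ω : Type*} [MeasurableSpace Ω] {M : MarkovProcess (StateSpace m n) Ω}

/-- The Laplace transform of the `i`-th coordinate at the argument `1`. -/
noncomputable def laplace (M : MarkovProcess (StateSpace m n) Ω) (t : ℝ≥0) (i : Fin m)
    (x : StateSpace m n) : ℝ :=
  ∫ y, Real.exp (-(y.1 i : ℝ)) ∂(M.law t x)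

theorem continuous_exp_neg_coord (i : Fin m) :
    Continuous fun y : StateSpace m n => Real.exp (-(y.1 i : ℝ)) := by
  fun_prop

theorem exp_neg_coord_le_one (i : Fin m) (y : StateSpace m n) : Real.exp (-(y.1 i : ℝ)) ≤ 1 :=
  Real.exp_le_one_iff.2 (neg_nonpos.2 (y.1 i).2)

theorem integrable_exp_neg_coord (t : ℝ≥0) (i : Fin m) (x : StateSpace m n) :
    Integrable (fun y : StateSpace m n => Real.exp (-(y.1 i : ℝ))) (M.law t x) :=
  Integrable.of_bound (continuous_exp_neg_coord i).aestronglyMeasurable 1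
    (ae_of_all _ fun y => by
      rw [Real.norm_eq_abs, Real.abs_exp]
      exact exp_neg_coord_le_one i y)

theorem laplace_nonneg (t : ℝ≥0) (i : Fin m) (x : StateSpace m n) : 0 ≤ laplace M t i x :=
  integral_nonneg fun _ => (Real.exp_pos _).le

theorem laplace_le_one (t : ℝ≥0) (i : Fin m) (x : StateSpace m n) : laplace M t i x ≤ 1 := by
  calc laplace M t i x ≤ ∫ _, (1 : ℝ) ∂(M.law t x) :=
        integral_mono (integrable_exp_neg_coord t i x) (integrable_const _)
          (exp_neg_coord_le_one i)
    _ = (M.law t x).real Set.univ := by simp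
    _ ≤ 1 := M.law_real_le_one _ _ _

theorem ofReal_laplace (t : ℝ≥0) (i : Fin m) (x : StateSpace m n) :
    ((laplace M t i x : ℝ) : ℂ)
      = M.semigroup t (fun y => ((Real.exp (-(y.1 i : ℝ)) : ℝ) : ℂ)) x := by
  rw [M.semigroup_eq_integral_law t (f := fun y => ((Real.exp (-(y.1 i : ℝ)) : ℝ) : ℂ))
    (Complex.continuous_ofReal.comp (continuous_exp_neg_coord i)).measurable]
  exact integral_complex_ofReal.symm

/-- The function `exp (-y_i)` turns addition on `D` into multiplication, so its integral turns
convolution into a product. -/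
theorem IsAffine.laplace_mul (haff : IsAffine M) (t : ℝ≥0) (i : Fin m) (x y : StateSpace m n) :
    laplace M t i x * laplace M t i y = laplace M t i (x + y) * laplace M t i 0 := by
  have key : ∀ x y : StateSpace m n, laplace M t i x * laplace M t i y
      = ∫ z, Real.exp (-(z.1 i : ℝ)) ∂(M.law t x ∗ M.law t y) := by
    intro x y
    rw [Measure.conv, integral_map measurable_add.aemeasurable
      (continuous_exp_neg_coord i).aestronglyMeasurable, laplace, laplace, ← integral_prod_mul]
    refine integral_congr_ae (ae_of_all _ fun p => ?_)
    simp only [Prod.fst_add, Pi.add_apply, NNReal.coe_add]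
    rw [← Real.exp_add]
    congr 1
    ring
  rw [key, key, haff.law_conv]

/-- Each unit added to the `i`-th coordinate multiplies the Laplace transform by a fixed ratio `q <
1`; Markov's inequality turns its decay into a bound on the mass of `{y_i ≤ R}`. -/
theorem IsAffine.law_coord_le (haff : IsAffine M) {t : ℝ≥0} {i : Fin m}
    (h0 : 1 / 2 < laplace M t i 0) (h1 : laplace M t i (Pi.single i 1, 0) < 1 / 2)
    (R : ℝ) {ε : ℝ} (hε : 0 < ε) :
    ∃ N : ℕ, ∀ x : StateSpace m n, (N : ℝ≥0) ≤ x.1 i →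
      (M.law t x).real {y | (y.1 i : ℝ) ≤ R} < ε := by
  set e : StateSpace m n := (Pi.single i 1, 0) with he
  set q := laplace M t i e / laplace M t i 0 with hq
  have hpos : 0 < laplace M t i 0 := by linarith
  have hq0 : 0 ≤ q := div_nonneg (laplace_nonneg _ _ _) hpos.le
  have hq1 : q < 1 := (div_lt_one hpos).2 (h1.trans h0)
  have hstep : ∀ x, laplace M t i (x + e) = q * laplace M t i x := by
    intro x
    have := haff.laplace_mul t i x e
    rw [hq]
    field_simp
    linarith
  have hiter : ∀ (N : ℕ) x, laplace M t i (x + N • e) = q ^ N * laplace M t i x := by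
    intro N
    induction N with
    | zero => simp
    | succ N ih =>
      intro x
      rw [succ_nsmul, ← add_assoc, hstep, ih]
      ring
  obtain ⟨N, hN⟩ := exists_pow_lt_of_lt_one (div_pos hε (Real.exp_pos R)) hq1
  refine ⟨N, fun x hx => ?_⟩
  obtain ⟨y, rfl⟩ : ∃ y : StateSpace m n, x = y + N • e := by
    refine ⟨(fun j => x.1 j - (N • e).1 j, x.2), Prod.ext (funext fun j => ?_) ?_⟩
    · have hle : (N • e).1 j ≤ x.1 j := by
        by_cases hij : j = i
        · subst hij
          simpa [he] using hx
        · simp [he, hij]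
      exact (tsub_add_cancel_of_le hle).symm
    · simp [he]
  have hle : laplace M t i (y + N • e) ≤ q ^ N := by
    rw [hiter]
    exact mul_le_of_le_one_right (pow_nonneg hq0 _) (laplace_le_one _ _ _)
  have hm : MeasurableSet {z : StateSpace m n | (z.1 i : ℝ) ≤ R} :=
    (isClosed_le (by fun_prop) continuous_const).measurableSet
  have hmarkov : Real.exp (-R) * (M.law t (y + N • e)).real {z | (z.1 i : ℝ) ≤ R}
      ≤ laplace M t i (y + N • e) := by
    calc Real.exp (-R) * (M.law t (y + N • e)).real {z | (z.1 i : ℝ) ≤ R}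
        ≤ Real.exp (-R) * (M.law t (y + N • e)).real
            {z | Real.exp (-R) ≤ Real.exp (-(z.1 i : ℝ))} := by
          refine mul_le_mul_of_nonneg_left (measureReal_mono fun z hz => ?_) (Real.exp_pos _).le
          exact Real.exp_le_exp.2 (neg_le_neg hz)
      _ ≤ _ := mul_meas_ge_le_integral_of_nonneg (ae_of_all _ fun _ => (Real.exp_pos _).le)
          (integrable_exp_neg_coord _ _ _) _
  rw [lt_div_iff₀ (Real.exp_pos R)] at hN
  have hexp : Real.exp R * Real.exp (-R) = 1 := by rw [← Real.exp_add]; simp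
  calc (M.law t (y + N • e)).real {z | (z.1 i : ℝ) ≤ R}
      = Real.exp R * (Real.exp (-R) * (M.law t (y + N • e)).real {z | (z.1 i : ℝ) ≤ R}) := by
        rw [← mul_assoc, hexp, one_mul]
    _ ≤ Real.exp R * q ^ N :=
        mul_le_mul_of_nonneg_left (hmarkov.trans hle) (Real.exp_pos R).le
    _ < ε := by linarith

/-- The law of the real-valued coordinates. -/
noncomputable def realLaw (M : MarkovProcess (StateSpace m n) Ω) (t : ℝ≥0)
    (x : StateSpace m n) : Measure (Fin n → ℝ) :=
  (M.law t x).map Prod.snd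

instance (t : ℝ≥0) (x : StateSpace m n) : IsFiniteMeasure (realLaw M t x) := by
  unfold realLaw
  infer_instance

theorem realLaw_real (t : ℝ≥0) (x : StateSpace m n) {s : Set (Fin n → ℝ)} (hs : MeasurableSet s) :
    (realLaw M t x).real s = (M.law t x).real (Prod.snd ⁻¹' s) :=
  map_measureReal_apply measurable_snd hs

theorem realLaw_univ_le (t : ℝ≥0) (x : StateSpace m n) : realLaw M t x Set.univ ≤ 1 := by
  rw [realLaw, Measure.map_apply measurable_snd MeasurableSet.univ]
  exact M.law_univ_le t x

theorem realLaw_real_univ_le (t : ℝ≥0) (x : StateSpace m n) :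
    (realLaw M t x).real Set.univ ≤ 1 := by
  rw [realLaw_real t x MeasurableSet.univ]
  exact M.law_real_le_one _ _ _

theorem IsAffine.realLaw_conv (haff : IsAffine M) (t : ℝ≥0) (x y : StateSpace m n) :
    realLaw M t x ∗ realLaw M t y = realLaw M t (x + y) ∗ realLaw M t 0 := by
  have h : ∀ x y, realLaw M t x ∗ realLaw M t y
      = (M.law t x ∗ M.law t y).map (AddMonoidHom.snd (Fin m → ℝ≥0) (Fin n → ℝ)) := by
    intro x y
    exact (Measure.map_conv_addMonoidHom (AddMonoidHom.snd (Fin m → ℝ≥0) (Fin n → ℝ))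
      measurable_snd).symm
  rw [h, h, haff.law_conv]

theorem measurableSet_le_norm (R : ℝ) : MeasurableSet {ξ : Fin n → ℝ | R ≤ ‖ξ‖} :=
  (isClosed_le continuous_const continuous_norm).measurableSet

theorem exists_realLaw_tail_lt (t : ℝ≥0) (x : StateSpace m n) {ε : ℝ} (hε : 0 < ε) :
    ∃ R : ℝ, (realLaw M t x).real {ξ | R ≤ ‖ξ‖} < ε := by
  have hanti : Antitone fun N : ℕ => {ξ : Fin n → ℝ | (N : ℝ) ≤ ‖ξ‖} :=
    fun a b hab ξ (hξ : (b : ℝ) ≤ ‖ξ‖) => (Nat.cast_le.2 hab).trans hξ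
  have h := tendsto_measure_iInter_atTop (μ := realLaw M t x)
    (fun N : ℕ => (measurableSet_le_norm (N : ℝ)).nullMeasurableSet) hanti
    ⟨0, measure_ne_top _ _⟩
  have hempty : ⋂ N : ℕ, {ξ : Fin n → ℝ | (N : ℝ) ≤ ‖ξ‖} = ∅ := by
    refine Set.eq_empty_of_forall_notMem fun ξ hξ => ?_
    obtain ⟨N, hN⟩ := exists_nat_gt ‖ξ‖
    exact hN.not_ge (Set.mem_iInter.1 hξ N)
  rw [hempty, measure_empty] at h
  have h' := (ENNReal.tendsto_toReal ENNReal.zero_ne_top).comp h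
  obtain ⟨N, hN⟩ := (h'.eventually (gt_mem_nhds hε)).exists
  exact ⟨N, hN⟩

/-- The laws of the real-valued coordinates are uniformly tight for starting points in a compact
set. -/
theorem IsAffine.exists_tail_lt_of_isCompact (haff : IsAffine M) {t : ℝ≥0} (h0 : M.law t 0 ≠ 0)
    {K : Set (StateSpace m n)} (hK : IsCompact K) {ε : ℝ} (hε : 0 < ε) :
    ∃ R : ℝ, ∀ x ∈ K, (realLaw M t x).real {ξ | R ≤ ‖ξ‖} < ε := by
  have hmono : ∀ (x : StateSpace m n) {R R' : ℝ}, R ≤ R' →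
      (realLaw M t x).real {ξ | R' ≤ ‖ξ‖} ≤ (realLaw M t x).real {ξ | R ≤ ‖ξ‖} :=
    fun x R R' h => measureReal_mono fun ξ (hξ : R' ≤ ‖ξ‖) => h.trans hξ
  refine hK.induction_on (p := fun s => ∃ R : ℝ, ∀ x ∈ s,
    (realLaw M t x).real {ξ | R ≤ ‖ξ‖} < ε) ⟨0, by simp⟩ ?_ ?_ ?_
  · rintro s s' hss' ⟨R, hR⟩
    exact ⟨R, fun x hx => hR x (hss' hx)⟩
  · rintro s s' ⟨R, hR⟩ ⟨R', hR'⟩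
    refine ⟨max R R', fun x hx => ?_⟩
    rcases hx with hx | hx
    · exact (hmono x (le_max_left _ _)).trans_lt (hR x hx)
    · exact (hmono x (le_max_right _ _)).trans_lt (hR' x hx)
  · intro a _
    obtain ⟨R, hR⟩ := exists_realLaw_tail_lt (M := M) t a hε
    -- A continuous cutoff between the indicators of `{R + 1 ≤ ‖y.2‖}` and `{R ≤ ‖y.2‖}`: weak
    -- continuity carries the bound at `a` to nearby starting points, at the price of enlarging `R`
    -- by one.
    let φ : BoundedContinuousFunction (StateSpace m n) ℝ :=
      BoundedContinuousFunction.ofNormedAddCommGroup (fun y => min 1 (max 0 (‖y.2‖ - R)))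
        (by fun_prop) 1 (fun y => by
          rw [Real.norm_of_nonneg (le_min zero_le_one (le_max_left _ _))]
          exact min_le_left _ _)
    have hφ : ∀ y, φ y = min 1 (max 0 (‖y.2‖ - R)) := fun _ => rfl
    have hms : ∀ R : ℝ, MeasurableSet {y : StateSpace m n | R ≤ ‖y.2‖} := fun R =>
      measurable_snd (measurableSet_le_norm R)
    have hup : ∫ y, φ y ∂(M.law t a) < ε := by
      refine lt_of_le_of_lt ?_ hR
      rw [realLaw_real t a (measurableSet_le_norm R)]
      change _ ≤ (M.law t a).real {y | R ≤ ‖y.2‖}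
      rw [← mul_one ((M.law t a).real _), ← smul_eq_mul, ← integral_indicator_const _ (hms R)]
      refine integral_mono (φ.integrable _) ((integrable_const _).indicator (hms R)) fun y => ?_
      by_cases hy : R ≤ ‖y.2‖
      · rw [Set.indicator_of_mem (by exact hy), hφ]
        exact min_le_left _ _
      · rw [Set.indicator_of_notMem (by exact hy), hφ, max_eq_left (by linarith)]
        exact min_le_right _ _
    refine ⟨_, mem_nhdsWithin_of_mem_nhds
      ((haff.continuous_integral t h0 φ).continuousAt.eventually (gt_mem_nhds hup)),
      R + 1, fun x hx => lt_of_le_of_lt ?_ hx⟩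
    rw [realLaw_real t x (measurableSet_le_norm _)]
    change (M.law t x).real {y | R + 1 ≤ ‖y.2‖} ≤ _
    rw [← mul_one ((M.law t x).real _), ← smul_eq_mul, ← integral_indicator_const _ (hms _)]
    refine integral_mono ((integrable_const _).indicator (hms _)) (φ.integrable _) fun y => ?_
    by_cases hy : R + 1 ≤ ‖y.2‖
    · rw [Set.indicator_of_mem (by exact hy), hφ]
      exact le_min le_rfl (le_max_of_le_right (by linarith))
    · rw [Set.indicator_of_notMem (by exact hy), hφ]
      exact le_min zero_le_one (le_max_left _ _)

/-- With `k` the integer part of `x.2`, convolving the law at `x` with the law at `-k` gives the law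
at a point of a compact set, convolved with the law at `0`; this is tight. But the law at `-k` has
mass above `1/2` near a remote `a`, so over half of the mass that `x` puts near `0` would be moved
near `a`. -/
theorem IsAffine.law_real_ball_lt (haff : IsAffine M) {t : ℝ≥0} {δ : ℝ}
    (hδn : 20 * (n + 1) * δ = 1)
    (h0 : 9 / 10 < (realLaw M t 0).real (Metric.ball 0 δ))
    (h1 : ∀ j, 9 / 10 < (realLaw M t (0, Pi.single j 1)).real (Metric.ball (Pi.single j 1) δ))
    (h2 : ∀ j, 9 / 10 < (realLaw M t (0, Pi.single j (-1))).real
      (Metric.ball (Pi.single j (-1)) δ))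
    (N : ℝ≥0) (R : ℝ) {ε : ℝ} (hε : 0 < ε) :
    ∃ N' : ℝ, ∀ x : StateSpace m n, (∀ i, x.1 i ≤ N) → N' ≤ ‖x.2‖ →
      (realLaw M t x).real (Metric.ball 0 R) < ε := by
  have hlaw0 : M.law t 0 ≠ 0 := by
    intro h
    rw [realLaw, h, Measure.map_zero] at h0
    norm_num at h0
  let b : (Fin n → ℤ) → StateSpace m n := fun k => (0, fun j => (k j : ℝ))
  have hb0 : b 0 = 0 := by
    ext j <;> simp [b]
  have hbs : ∀ (j : Fin n) (s : ℤ), b (Pi.single j s) = (0, Pi.single j (s : ℝ)) := by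
    intro j s
    refine Prod.ext rfl (funext fun i => ?_)
    by_cases hij : i = j
    · subst hij; simp [b]
    · simp [b, hij]
  have hcenter := exists_center_of_conv (fun k => realLaw M t (b k)) (fun k => realLaw_univ_le t _)
    (fun k l => by
      have : b (k + l) = b k + b l := by
        ext j <;> simp [b]
      simp only [this, hb0]
      exact haff.realLaw_conv t _ _) hδn (by simpa only [hb0] using h0)
    (fun j => by simpa [hbs] using h1 j) (fun j => by simpa [hbs] using h2 j)
  have hK : IsCompact ((Set.pi Set.univ fun _ : Fin m => Set.Icc (0 : ℝ≥0) N) ×ˢ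
      (Set.pi Set.univ fun _ : Fin n => Set.Icc (0 : ℝ) 1)) :=
    (isCompact_univ_pi fun _ => isCompact_Icc).prod (isCompact_univ_pi fun _ => isCompact_Icc)
  obtain ⟨R₁, hR₁⟩ := haff.exists_tail_lt_of_isCompact hlaw0 hK (ε := ε / 4) (by positivity)
  obtain ⟨R₂, hR₂⟩ := exists_realLaw_tail_lt (M := M) t 0 (ε := ε / 4) (by positivity)
  have hmono : ∀ (x : StateSpace m n) {R R' : ℝ}, R ≤ R' →
      (realLaw M t x).real {ξ | R' ≤ ‖ξ‖} ≤ (realLaw M t x).real {ξ | R ≤ ‖ξ‖} :=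
    fun x R R' h => measureReal_mono fun ξ (hξ : R' ≤ ‖ξ‖) => h.trans hξ
  set R' := max R₁ R₂ with hR'
  -- The center satisfies `‖a‖ ≥ (‖x.2‖ - 1)/2 - 1/2`, so this bound gives `‖a‖ ≥ 2R' + (R + 2δ)`,
  -- and the ball of radius `R + 2δ` about `a` stays outside radius `2R'`.
  refine ⟨2 * (2 * R' + (R + 2 * δ) + 1), fun x hxN hx => ?_⟩
  let k : Fin n → ℤ := fun j => ⌊x.2 j⌋
  let y : StateSpace m n := (x.1, fun j => Int.fract (x.2 j))
  have hy : y ∈ (Set.pi Set.univ fun _ : Fin m => Set.Icc (0 : ℝ≥0) N) ×ˢ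
      (Set.pi Set.univ fun _ : Fin n => Set.Icc (0 : ℝ) 1) :=
    ⟨fun i _ => ⟨zero_le, hxN i⟩, fun j _ => ⟨Int.fract_nonneg _, (Int.fract_lt_one _).le⟩⟩
  have hxy : x + b (-k) = y := by
    ext j
    · simp [b, y]
    · simp only [b, y, k, Prod.snd_add, Pi.add_apply, Pi.neg_apply, Int.cast_neg]
      exact (sub_eq_add_neg _ _).symm
  obtain ⟨a, ha, hak⟩ := hcenter (-k)
  have hkx : ‖x.2‖ - 1 ≤ ‖fun j => (((-k) j : ℤ) : ℝ)‖ := by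
    have e : x.2 = y.2 - fun j => (((-k) j : ℤ) : ℝ) := by
      rw [← hxy]
      simp [b]
    have hy2 : ‖y.2‖ ≤ 1 := by
      refine (pi_norm_le_iff_of_nonneg zero_le_one).2 fun j => ?_
      rw [Real.norm_of_nonneg (Int.fract_nonneg _)]
      exact (Int.fract_lt_one _).le
    have := norm_sub_le y.2 (fun j => (((-k) j : ℤ) : ℝ))
    rw [← e] at this
    linarith
  have h3 := measureReal_ball_mul_le_conv (realLaw M t x) (realLaw M t (b (-k))) 0 a R (2 * δ)
  rw [zero_add, haff.realLaw_conv, hxy] at h3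
  have h4 : (realLaw M t y ∗ realLaw M t 0).real (Metric.ball a (R + 2 * δ))
      ≤ (realLaw M t y ∗ realLaw M t 0).real {ξ | 2 * R' ≤ ‖ξ‖} := by
    refine measureReal_mono fun ξ hξ => ?_
    rw [Metric.mem_ball, dist_comm, dist_eq_norm] at hξ
    have := norm_sub_norm_le a ξ
    change 2 * R' ≤ ‖ξ‖
    linarith
  have h5 := conv_measureReal_norm_ge_le (realLaw_real_univ_le (M := M) t y)
    (realLaw_real_univ_le (M := M) t 0) R'
  have h6 := (hmono y (le_max_left R₁ R₂)).trans_lt (hR₁ y hy)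
  have h7 := (hmono 0 (le_max_right R₁ R₂)).trans_lt hR₂
  have h8 : 0 ≤ (realLaw M t x).real (Metric.ball 0 R) := measureReal_nonneg
  have h9 := mul_le_mul_of_nonneg_left ha.le h8
  -- Half of the mass in question is at most the sum of two tails, each below `ε/4`.
  linarith

theorem eventually_realLaw_ball (hcont : M.IsStochasticallyContinuous) (x : StateSpace m n)
    {δ : ℝ} (hδ : 0 < δ) :
    ∀ᶠ t in 𝓝 (0 : ℝ≥0), 9 / 10 < (realLaw M t x).real (Metric.ball x.2 δ) := by
  have h := hcont.eventually_lt_law x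
    (U := Prod.snd ⁻¹' Metric.ball x.2 δ)
    (continuous_snd.continuousAt (Metric.ball_mem_nhds _ hδ))
    (measurable_snd Metric.isOpen_ball.measurableSet) (c := 9 / 10) (by norm_num)
  filter_upwards [h] with t ht
  rwa [realLaw_real _ _ Metric.isOpen_ball.measurableSet]

theorem tendsto_laplace (hcont : M.IsStochasticallyContinuous) (i : Fin m) (x : StateSpace m n) :
    Tendsto (fun t => laplace M t i x) (𝓝 0) (𝓝 (Real.exp (-(x.1 i : ℝ)))) := by
  have hc := Complex.continuous_ofReal.comp (continuous_exp_neg_coord (n := n) i)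
  have h := hcont.tendsto_semigroup x hc.measurable (C := 1)
    (fun y => by
      rw [Function.comp_apply, Complex.norm_real, Real.norm_eq_abs, Real.abs_exp]
      exact exp_neg_coord_le_one i y) hc.continuousAt
  have h2 := Complex.continuous_re.continuousAt.tendsto.comp h
  refine h2.congr fun t => ?_
  have := ofReal_laplace (M := M) t i x
  exact (congrArg Complex.re this).symm

/-- For small times the mass of every bounded set tends to zero as the starting point tends to
infinity. -/
theorem IsAffine.eventually_law_real_lt (haff : IsAffine M) (hcont : M.IsStochasticallyContinuous) :
    ∀ᶠ t in 𝓝 (0 : ℝ≥0), M.law t 0 ≠ 0 ∧ ∀ (R : ℝ) (ε : ℝ), 0 < ε →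
      ∀ᶠ x in cocompact (StateSpace m n),
        (M.law t x).real {y | (∀ i, (y.1 i : ℝ) ≤ R) ∧ ‖y.2‖ < R} < ε := by
  have hδ : (0 : ℝ) < 1 / (20 * (n + 1)) := by positivity
  have hδn : 20 * ((n : ℝ) + 1) * (1 / (20 * (n + 1))) = 1 := by field_simp
  -- The threshold `1/2` separates the limits `1` and `exp (-1)` of the two Laplace transforms as `t
  -- → 0`.
  have e1 := eventually_all.2 fun i : Fin m =>
    (tendsto_laplace hcont i 0).eventually (lt_mem_nhds (a := 1 / 2) (by norm_num))
  have hexp : ∀ i : Fin m, Real.exp (-((Pi.single i 1 : Fin m → ℝ≥0) i : ℝ)) < 1 / 2 := by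
    intro i
    rw [Pi.single_eq_same, NNReal.coe_one, Real.exp_neg, one_div]
    exact inv_strictAnti₀ (by norm_num) (by linarith [Real.exp_one_gt_d9])
  have e2 := eventually_all.2 fun i : Fin m =>
    (tendsto_laplace hcont i (Pi.single i 1, 0)).eventually (gt_mem_nhds (hexp i))
  have e3 := eventually_realLaw_ball hcont 0 hδ
  have e4 := eventually_all.2 fun j : Fin n =>
    eventually_realLaw_ball hcont (0, Pi.single j 1) hδ
  have e5 := eventually_all.2 fun j : Fin n =>
    eventually_realLaw_ball hcont (0, Pi.single j (-1)) hδ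
  filter_upwards [e1, e2, e3, e4, e5] with t h1 h2 h3 h4 h5
  refine ⟨fun h => ?_, fun R ε hε => ?_⟩
  · rw [realLaw, h, Measure.map_zero] at h3
    norm_num at h3
  choose N hN using fun i => haff.law_coord_le (h1 i) (h2 i) R hε
  let N₀ : ℝ≥0 := ((Finset.univ.sup N : ℕ) : ℝ≥0)
  obtain ⟨N', hN'⟩ := haff.law_real_ball_lt hδn h3 h4 h5 N₀ R hε
  have hK : IsCompact ((Set.pi Set.univ fun _ : Fin m => Set.Icc (0 : ℝ≥0) N₀) ×ˢ
      Metric.closedBall (0 : Fin n → ℝ) N') :=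
    (isCompact_univ_pi fun _ => isCompact_Icc).prod (isCompact_closedBall _ _)
  filter_upwards [hK.compl_mem_cocompact] with x hx
  -- Outside the compact set, either the real part is large while the other coordinates are bounded,
  -- or some nonnegative coordinate is large.
  by_cases hxN : ∀ i, x.1 i ≤ N₀
  · have hx2 : N' ≤ ‖x.2‖ := by
      by_contra! hcon
      exact hx ⟨fun i _ => ⟨zero_le, hxN i⟩, by simpa using hcon.le⟩
    refine lt_of_le_of_lt ?_ (hN' x hxN hx2)
    rw [realLaw_real _ _ Metric.isOpen_ball.measurableSet]
    refine measureReal_mono fun y hy => ?_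
    simpa using hy.2
  · push Not at hxN
    obtain ⟨i, hi⟩ := hxN
    refine lt_of_le_of_lt (measureReal_mono fun y hy => ?_) (hN i x ?_)
    · exact hy.1 i
    · exact (Nat.cast_le.2 (Finset.le_sup (Finset.mem_univ i))).trans hi.le

theorem IsAffine.exists_zeroAtInfty (haff : IsAffine M) {t : ℝ≥0} (h0 : M.law t 0 ≠ 0)
    (h : ∀ (R : ℝ) (ε : ℝ), 0 < ε → ∀ᶠ x in cocompact (StateSpace m n),
        (M.law t x).real {y | (∀ i, (y.1 i : ℝ) ≤ R) ∧ ‖y.2‖ < R} < ε)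
    (f : C₀(StateSpace m n, ℂ)) :
    ∃ g : C₀(StateSpace m n, ℂ), ∀ x, g x = M.semigroup t f x := by
  have hrepr : ∀ x, M.semigroup t f x = ∫ y, f.toBCF y ∂(M.law t x) := fun x =>
    M.semigroup_eq_integral_law t (f := f) f.continuous.measurable x
  have hc : Continuous (M.semigroup t f) := by
    rw [funext hrepr]
    exact haff.continuous_integral t h0 f.toBCF
  refine ⟨⟨⟨M.semigroup t f, hc⟩, ?_⟩, fun x => rfl⟩
  change Tendsto (M.semigroup t f) _ _
  rw [Metric.tendsto_nhds]
  intro ε hε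
  set C := ‖f.toBCF‖ with hC
  have hC0 : 0 ≤ C := norm_nonneg _
  have hf : ∀ᶠ y in cocompact (StateSpace m n), ‖f y‖ < ε / 2 := by
    have := (ZeroAtInftyContinuousMapClass.zero_at_infty f).eventually
      (Metric.ball_mem_nhds 0 (half_pos hε))
    simpa using this
  obtain ⟨K, hK, hKf⟩ := mem_cocompact.1 hf
  obtain ⟨R, hR⟩ : ∃ R : ℝ, K ⊆ {y | (∀ i, (y.1 i : ℝ) ≤ R) ∧ ‖y.2‖ < R} := by
    obtain ⟨R, hR⟩ := hK.isBounded.subset_closedBall 0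
    refine ⟨R + 1, fun y hy => ?_⟩
    have hd : dist y 0 ≤ R := hR hy
    rw [Prod.dist_eq, max_le_iff] at hd
    constructor
    · intro i
      have h1 := (dist_le_pi_dist y.1 (0 : StateSpace m n).1 i).trans hd.1
      rw [NNReal.dist_eq] at h1
      simp only [Prod.fst_zero, Pi.zero_apply, NNReal.coe_zero, sub_zero] at h1
      linarith [le_abs_self (y.1 i : ℝ)]
    · have h2 := hd.2
      rw [dist_eq_norm, Prod.snd_zero, sub_zero] at h2
      linarith
  set B : Set (StateSpace m n) := {y | (∀ i, (y.1 i : ℝ) ≤ R) ∧ ‖y.2‖ < R} with hB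
  have hBm : MeasurableSet B := by
    refine MeasurableSet.inter ?_ ?_
    · change MeasurableSet {y : StateSpace m n | ∀ i, (y.1 i : ℝ) ≤ R}
      rw [Set.ofPred_forall]
      exact MeasurableSet.iInter fun i =>
        (isClosed_le (f := fun y : StateSpace m n => (y.1 i : ℝ))
          (by fun_prop) continuous_const).measurableSet
    · exact (isOpen_lt (f := fun y : StateSpace m n => ‖y.2‖) (by fun_prop)
        continuous_const).measurableSet
  -- `C + 1` replaces `C` in the denominator because `C` may be zero.
  filter_upwards [h R (ε / (2 * (C + 1))) (by positivity)] with x hx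
  rw [dist_zero_right, hrepr]
  have hx' : C * (M.law t x).real B < ε / 2 := by
    rw [lt_div_iff₀ (by positivity)] at hx
    nlinarith [measureReal_nonneg (μ := M.law t x) (s := B)]
  calc ‖∫ y, f.toBCF y ∂(M.law t x)‖
      ≤ ∫ y, (ε / 2 + B.indicator (fun _ => C) y) ∂(M.law t x) := by
        refine norm_integral_le_of_norm_le
          ((integrable_const _).add ((integrable_const _).indicator hBm)) (ae_of_all _ fun y => ?_)
        by_cases hy : y ∈ B
        · rw [Set.indicator_of_mem hy]
          linarith [f.toBCF.norm_coe_le_norm y]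
        · rw [Set.indicator_of_notMem hy, add_zero]
          exact (hKf fun hyK => hy (hR hyK)).le
    _ = ε / 2 * (M.law t x).real Set.univ + C * (M.law t x).real B := by
        rw [integral_add (integrable_const _) ((integrable_const _).indicator hBm),
          integral_indicator_const _ hBm]
        simp [mul_comm]
    _ < ε := by
        have := mul_le_of_le_one_right (half_pos hε).le (M.law_real_le_one t x Set.univ)
        linarith

end Feller

end AffineProcess

theorem mainTheorem2 (m n : ℕ) {Ω : Type*} [MeasurableSpace Ω]
    (M : AffineProcess.MarkovProcess (AffineProcess.StateSpace m n) Ω)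
    (hcont : M.IsStochasticallyContinuous) (haff : AffineProcess.IsAffine M) :
    M.IsFeller := by
  refine M.isFeller_of_eventually hcont ?_
  filter_upwards [haff.eventually_law_real_lt hcont] with t ht f
  exact haff.exists_zeroAtInfty ht.1 ht.2 f
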